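/- Order $\mathbb N^2$ (with $0\in\mathbb N$) componentwise by $\le$, write $\alpha\wedge\beta$ for the componentwise minimum, and write $\alpha\ll\beta$ if $\alpha_1<\beta_1$ and $\alpha_2<\beta_2$. A *good semigroup* is a submonoid $S$ of $(\mathbb N^2,+)$ such that - (G1) $\alpha\wedge\beta\in S$ for all $\alpha,\beta\in S$; - (G2) if $\alpha,\beta\in S$, $\{i,j\}=\{1,2\}$ and $\alpha_i=\beta_i$, then there is $\delta\in S$ with $\delta_i>\alpha_i$, $\delta_j\ge\min(\alpha_j,\beta_j)$, and $\delta_j=\min(\alpha_j,\beta_j)$ if $\alpha_j\ne\beta_j$; - (G3) there is $c\in S$ with $c+\mathbb N^2\subseteq S$. It is *local* if $(0,0)$ is its only element with a zero component. Let $S$ be a local good semigroup. Let $c$ be the minimum of all $c$ with $c+\mathbb N^2\subseteq S$, let $\gamma=c-(1,1)$, let $\mathbf e=(e_1,e_2)$ be the smallest nonzero element of $S$, and let $e=e_1+e_2$. For $\alpha\in\mathbb Z^2$ let $\Delta^S(\alpha)$ be the set of all $\beta\in S$ with ($\beta_1=\alpha_1$ and $\beta_2>\alpha_2$) or ($\beta_2=\alpha_2$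 and $\beta_1>\alpha_1$). $S$ is *symmetric* if for every $\alpha\in\mathbb N^2$: $\alpha\in S$ if and only if $\Delta^S(\gamma-\alpha)=\emptyset$. Let $\mathrm{Ap}(S)=\{\alpha\in S:\alpha-\mathbf e\notin S\}$. For $i\ge1$ define recursively $B^{(i)}$ as the set of those elements $\alpha$ of $X_i=\mathrm{Ap}(S)\setminus\bigcup_{j<i}D^{(j)}$ for which no $\beta\in X_i$ satisfies $\alpha\ll\beta$, $C^{(i)}$ as the set of those $\alpha\in B^{(i)}$ with $\alpha=\beta\wedge\beta'$ for some $\beta,\beta'\in B^{(i)}\setminus\{\alpha\}$, and $D^{(i)}=B^{(i)}\setminus C^{(i)}$. Let $N$ be the least number with $\mathrm{Ap}(S)=\bigcup_{i=1}^N D^{(i)}$, and define the levels $A_i=D^{(N+1-i)}$ for $1\le i\le N$. (It is known that $N=e$.) **Corollary.** Let $S\subseteq\mathbb N^2$ be a symmetric local good semigroup, let $1\le i\le e$ and let $\alpha\in A_{e-i+1}$. Then every element of $\Delta^S(\gamma+\mathbf e-\alpha)$ that is minimal with respect to $\le$ belongs to $A_i$. -/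

import Mathlib

namespace GoodSemigroup

/-- A submonoid `S` of `(ℕ², +)` is a good semigroup if it is closed under componentwise minima
(`inf_mem`), satisfies the exchange axiom in each of the two components (`exchange_fst`,
`exchange_snd`) and contains a translate of `ℕ²` based at one of its elements (`exists_conductor`). -/
structure IsGood (S : AddSubmonoid (ℕ × ℕ)) : Prop where
  inf_mem : ∀ a ∈ S, ∀ b ∈ S, a ⊓ b ∈ S
  exchange_fst : ∀ a ∈ S, ∀ b ∈ S, a.1 = b.1 →
    ∃ d ∈ S, a.1 < d.1 ∧ min a.2 b.2 ≤ d.2 ∧ (a.2 ≠ b.2 → d.2 = min a.2 b.2)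
  exchange_snd : ∀ a ∈ S, ∀ b ∈ S, a.2 = b.2 →
    ∃ d ∈ S, a.2 < d.2 ∧ min a.1 b.1 ≤ d.1 ∧ (a.1 ≠ b.1 → d.1 = min a.1 b.1)
  exists_conductor : ∃ c ∈ S, ∀ n : ℕ × ℕ, c + n ∈ S

/-- `S` is local if `0 = (0, 0)` is its only element with a zero component. -/
def IsLocal (S : AddSubmonoid (ℕ × ℕ)) : Prop :=
  ∀ a ∈ S, a.1 = 0 ∨ a.2 = 0 → a = 0

/-- A nonempty subset of `ℕ²` that is closed under componentwise minima has its componentwise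
infimum as least element. -/
theorem isLeast_sInf_of_inf_mem (X : Set (ℕ × ℕ)) (hne : X.Nonempty)
    (hX : ∀ a ∈ X, ∀ b ∈ X, a ⊓ b ∈ X) : IsLeast X (sInf X) := by
  have h1 : (sInf X).1 = sInf (Prod.fst '' X) := rfl
  have h2 : (sInf X).2 = sInf (Prod.snd '' X) := rfl
  have hlow : ∀ a ∈ X, sInf X ≤ a := fun a ha =>
    ⟨h1 ▸ Nat.sInf_le ⟨a, ha, rfl⟩, h2 ▸ Nat.sInf_le ⟨a, ha, rfl⟩⟩
  obtain ⟨a, ha, ha1⟩ := Nat.sInf_mem (hne.image Prod.fst)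
  obtain ⟨b, hb, hb2⟩ := Nat.sInf_mem (hne.image Prod.snd)
  have hab : sInf X = a ⊓ b := by
    apply le_antisymm (le_inf (hlow a ha) (hlow b hb))
    exact ⟨(inf_le_left : a ⊓ b ≤ a).1.trans (ha1.trans h1.symm).le,
      (inf_le_right : a ⊓ b ≤ b).2.trans (hb2.trans h2.symm).le⟩
  exact ⟨hab ▸ hX a ha b hb, fun x hx => hlow x hx⟩

/-- The conductor of `S`: the minimum of the `c` with `c + ℕ² ⊆ S`
(for a good semigroup it is a minimum, see `isLeast_conductor`). -/
noncomputable def conductor (S : AddSubmonoid (ℕ × ℕ)) : ℕ × ℕ :=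
  sInf {c : ℕ × ℕ | ∀ n : ℕ × ℕ, c + n ∈ S}

theorem isLeast_conductor (S : AddSubmonoid (ℕ × ℕ)) (hS : IsGood S) :
    IsLeast {c : ℕ × ℕ | ∀ n : ℕ × ℕ, c + n ∈ S} (conductor S) := by
  obtain ⟨c, -, hc⟩ := hS.exists_conductor
  refine isLeast_sInf_of_inf_mem _ ⟨c, hc⟩ fun a ha b hb n => ?_
  have := hS.inf_mem _ (ha n) _ (hb n)
  have h : a ⊓ b + n = (a + n) ⊓ (b + n) := by
    ext <;> simp [min_add_add_right]
  rw [h]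
  exact this

/-- `γ = c - (1, 1)`, as an element of `ℤ²`. -/
noncomputable def gammaVec (S : AddSubmonoid (ℕ × ℕ)) : ℤ × ℤ :=
  (((conductor S).1 : ℤ) - 1, ((conductor S).2 : ℤ) - 1)

/-- `e = (e₁, e₂)`: the smallest nonzero element of `S`
(for a local good semigroup it is a minimum, see `isLeast_minNonzero`). -/
noncomputable def minNonzero (S : AddSubmonoid (ℕ × ℕ)) : ℕ × ℕ :=
  sInf {a : ℕ × ℕ | a ∈ S ∧ a ≠ 0}

theorem isLeast_minNonzero (S : AddSubmonoid (ℕ × ℕ)) (hS : IsGood S) (hl : IsLocal S) :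
    IsLeast {a : ℕ × ℕ | a ∈ S ∧ a ≠ 0} (minNonzero S) := by
  obtain ⟨c, -, hc⟩ := hS.exists_conductor
  refine isLeast_sInf_of_inf_mem _ ⟨c + (1, 1), hc _, fun h => ?_⟩ ?_
  · have := congrArg Prod.fst h
    simp at this
  · rintro a ⟨ha, ha0⟩ b ⟨hb, hb0⟩
    refine ⟨hS.inf_mem a ha b hb, fun h => ?_⟩
    have h' : min a.1 b.1 = 0 := congrArg Prod.fst h
    rcases min_choice a.1 b.1 with h1 | h1
    · exact ha0 (hl a ha (Or.inl (h1 ▸ h')))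
    · exact hb0 (hl b hb (Or.inl (h1 ▸ h')))

/-- `Δ^S(a)` for `a ∈ ℤ²`: the elements of `S` that share exactly one component with `a` and are
strictly larger than `a` in the other one. -/
def deltaS (S : AddSubmonoid (ℕ × ℕ)) (a : ℤ × ℤ) : Set (ℕ × ℕ) :=
  {b | b ∈ S ∧ (((b.1 : ℤ) = a.1 ∧ a.2 < (b.2 : ℤ)) ∨ ((b.2 : ℤ) = a.2 ∧ a.1 < (b.1 : ℤ)))}

/-- The vector `a ∈ ℕ²` viewed in `ℤ²`. -/
def toIntVec (a : ℕ × ℕ) : ℤ × ℤ := ((a.1 : ℤ), (a.2 : ℤ))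

/-- `S` is symmetric if, for every `a ∈ ℕ²`, `a ∈ S` if and only if `Δ^S(γ - a) = ∅`. -/
def IsSymmetric (S : AddSubmonoid (ℕ × ℕ)) : Prop :=
  ∀ a : ℕ × ℕ, a ∈ S ↔ deltaS S (gammaVec S - toIntVec a) = ∅

/-- The Apéry set of `S` with respect to `e`: the `a ∈ S` with `a - e ∉ S`. -/
noncomputable def aperySet (S : AddSubmonoid (ℕ × ℕ)) : Set (ℕ × ℕ) :=
  {a | a ∈ S ∧ ¬ ∃ s ∈ S, s + minNonzero S = a}

/-- `a ≪ b`: strict inequality in both components. -/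
def StrictlyDominated (a b : ℕ × ℕ) : Prop := a.1 < b.1 ∧ a.2 < b.2

/-- The elements of `X` that are maximal with respect to the order `a = b ∨ a ≪ b`. -/
def maximalPart (X : Set (ℕ × ℕ)) : Set (ℕ × ℕ) :=
  {a | a ∈ X ∧ ∀ b ∈ X, ¬ StrictlyDominated a b}

/-- The elements of `B` that are the infimum of two elements of `B` different from them. -/
def infimumPart (B : Set (ℕ × ℕ)) : Set (ℕ × ℕ) :=
  {a | a ∈ B ∧ ∃ b₁ ∈ B \ {a}, ∃ b₂ ∈ B \ {a}, a = b₁ ⊓ b₂}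

/-- One step of the construction of the levels: the maximal elements `B` of `X`, without those
that are the infimum of two other elements of `B`. -/
def topLayer (X : Set (ℕ × ℕ)) : Set (ℕ × ℕ) :=
  maximalPart X \ infimumPart (maximalPart X)

/-- What is left of the Apéry set after the first `k` layers have been removed. -/
noncomputable def aperyRest (S : AddSubmonoid (ℕ × ℕ)) : ℕ → Set (ℕ × ℕ)
  | 0 => aperySet S
  | k + 1 => aperyRest S k \ topLayer (aperyRest S k)

/-- The layers `D⁽¹⁾, D⁽²⁾, …` of the Apéry set, from the top down; `D⁽ⁱ⁾` is the top layer of the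
Apéry set minus `D⁽¹⁾ ∪ … ∪ D⁽ⁱ⁻¹⁾` (and `D⁽⁰⁾ = ∅` by convention). -/
noncomputable def layerD (S : AddSubmonoid (ℕ × ℕ)) : ℕ → Set (ℕ × ℕ)
  | 0 => ∅
  | k + 1 => topLayer (aperyRest S k)

theorem aperyRest_eq (S : AddSubmonoid (ℕ × ℕ)) (k : ℕ) :
    aperyRest S k = aperySet S \ ⋃ j ∈ Set.Icc 1 k, layerD S j := by
  induction k with
  | zero => simp [aperyRest]
  | succ k ih =>
    have h : (⋃ j ∈ Set.Icc 1 (k + 1), layerD S j) =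
        (⋃ j ∈ Set.Icc 1 k, layerD S j) ∪ topLayer (aperyRest S k) := by
      rw [← Set.insert_Icc_right_eq_Icc_add_one (by omega), Set.biUnion_insert, Set.union_comm]
      rfl
    rw [h, ← Set.sdiff_sdiff, ← ih]
    rfl

/-- The number `N` of layers: the least `N` such that the Apéry set is `D⁽¹⁾ ∪ … ∪ D⁽ᴺ⁾`. -/
noncomputable def numLevels (S : AddSubmonoid (ℕ × ℕ)) : ℕ :=
  sInf {N : ℕ | aperySet S = ⋃ i ∈ Set.Icc 1 N, layerD S i}

/-- The levels `A₁, …, A_N` of the Apéry set, numbered in increasing order: `Aᵢ = D⁽ᴺ⁺¹⁻ⁱ⁾`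
(meaningful for `1 ≤ i ≤ N`). -/
noncomputable def aperyLevel (S : AddSubmonoid (ℕ × ℕ)) (i : ℕ) : Set (ℕ × ℕ) :=
  layerD S (numLevels S + 1 - i)

end GoodSemigroup

namespace GoodSemigroup

/-! Write S(p) for the elements of S that are ≥ p, and call the length of S(p) modulo (**e** + S)(p)
the relative length at p. It equals e far below the origin and 0 far beyond γ + **e**. Along a unit
step it drops by 0 or 1, according to which rays meet S and **e** + S. Three facts give the result.
On Ap(S) the relative length is exactly the index of the layer D (`topLayer_aperyLength`), so N = e
is its value at 0. Symmetry says that a ray meets S iff the dual ray does not, so the relative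
lengths at p and γ + **e** + (1,1) - p add up to e (`relLength_add_dual`). A minimal β in Δ(γ +
**e** - α) has relative length one more than the point γ + **e** + (1,1) - α dual to α
(`aperyLength_of_minimal`). Hence the layer indices of α and β add up to e + 1. -/

/-- A binary relation on `ℤ` that describes membership in a symmetric good semigroup with
`γ = (g₁, g₂)`. -/
structure IsSymmetricGoodRel (P : ℤ → ℤ → Prop) (g₁ g₂ : ℤ) : Prop where
  nonneg_fst : ∀ {x y}, P x y → 0 ≤ x
  nonneg_snd : ∀ {x y}, P x y → 0 ≤ y
  zero : P 0 0
  add : ∀ {x y x' y'}, P x y → P x' y' → P (x + x') (y + y')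
  inf : ∀ {x y x' y'}, P x y → P x' y' → P (min x x') (min y y')
  exchange_right : ∀ {x y y'}, P x y → P x y' → y < y' → ∃ x', x < x' ∧ P x' y
  exchange_up : ∀ {x y x'}, P x y → P x' y → x < x' → ∃ y', y < y' ∧ P x y'
  far : ∀ {x y}, g₁ < x → g₂ < y → P x y
  symm : ∀ x y, P x y ↔ ¬ ((∃ t, g₂ - y < t ∧ P (g₁ - x) t) ∨ ∃ t, g₁ - x < t ∧ P t (g₂ - y))

/-! ### Rays and the lengths obtained by counting them. -/

/-- The closed vertical ray above `(x, y)` meets `P`. -/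
def RayUp (P : ℤ → ℤ → Prop) (x y : ℤ) : Prop := ∃ t, y ≤ t ∧ P x t

/-- The closed horizontal ray to the right of `(x, y)` meets `P`. -/
def RayRight (P : ℤ → ℤ → Prop) (x y : ℤ) : Prop := ∃ t, x ≤ t ∧ P t y

open Classical in
/-- The indicator of a proposition. -/
noncomputable def indicator (p : Prop) : ℤ := if p then 1 else 0

theorem indicator_of_true {p : Prop} (h : p) : indicator p = 1 := by
  classical
  exact if_pos h

theorem indicator_of_false {p : Prop} (h : ¬ p) : indicator p = 0 := by
  classical
  exact if_neg h

theorem indicator_le_one (p : Prop) : indicator p ≤ 1 := by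
  by_cases h : p
  · rw [indicator_of_true h]
  · rw [indicator_of_false h]; norm_num

theorem indicator_nonneg (p : Prop) : 0 ≤ indicator p := by
  by_cases h : p
  · rw [indicator_of_true h]; norm_num
  · rw [indicator_of_false h]

theorem indicator_mono {p q : Prop} (h : p → q) : indicator p ≤ indicator q := by
  by_cases hp : p
  · rw [indicator_of_true hp, indicator_of_true (h hp)]
  · rw [indicator_of_false hp]; exact indicator_nonneg q

theorem indicator_not {p q : Prop} (h : p ↔ ¬ q) : indicator p = 1 - indicator q := by
  by_cases hq : q
  · rw [indicator_of_true hq, indicator_of_false (fun hp => h.1 hp hq)]; norm_num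
  · rw [indicator_of_false hq, indicator_of_true (h.2 hq)]; norm_num

/-- The potential on `ℤ²` whose differences along unit steps are the indicators of the rays. -/
noncomputable def potential (P : ℤ → ℤ → Prop) (x y : ℤ) : ℤ :=
  -(∑ a ∈ Finset.range x.toNat, indicator (RayUp P a 0))
    - ∑ b ∈ Finset.range y.toNat, indicator (RayRight P x b)

/-- The length of the part of the semigroup above `(x, y)` modulo its translate by `(e₁, e₂)`. -/
noncomputable def relLength (P : ℤ → ℤ → Prop) (e₁ e₂ : ℤ) (x y : ℤ) : ℤ :=
  e₁ + e₂ + potential P x y - potential P (x - e₁) (y - e₂)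

namespace IsSymmetricGoodRel

variable {P : ℤ → ℤ → Prop} {g₁ g₂ : ℤ}

theorem swap (hP : IsSymmetricGoodRel P g₁ g₂) :
    IsSymmetricGoodRel (fun x y => P y x) g₂ g₁ where
  nonneg_fst h := hP.nonneg_snd h
  nonneg_snd h := hP.nonneg_fst h
  zero := hP.zero
  add h h' := hP.add h h'
  inf h h' := hP.inf h h'
  exchange_right h h' := hP.exchange_up h h'
  exchange_up h h' := hP.exchange_right h h'
  far h h' := hP.far h' h
  symm x y := by rw [hP.symm y x, or_comm]

theorem mem_of_rays (hP : IsSymmetricGoodRel P g₁ g₂) {x y : ℤ} (hu : RayUp P x y)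
    (hr : RayRight P x y) : P x y := by
  obtain ⟨t, ht, hu⟩ := hu
  obtain ⟨s, hs, hr⟩ := hr
  have := hP.inf hu hr
  rwa [min_eq_left hs, min_eq_right ht] at this

/-- Path independence around a unit square. If the corner lies in `P`, exchange converts an element
to its right into one above it and conversely; if not, deleting the corner changes neither ray. -/
theorem square (hP : IsSymmetricGoodRel P g₁ g₂) (x y : ℤ) :
    indicator (RayUp P x y) + indicator (RayRight P (x + 1) y) =
      indicator (RayRight P x y) + indicator (RayUp P x (y + 1)) := by
  by_cases h : P x y
  · rw [indicator_of_true (p := RayUp P x y) ⟨y, le_rfl, h⟩,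
      indicator_of_true (p := RayRight P x y) ⟨x, le_rfl, h⟩]
    congr 1
    by_cases hr : RayRight P (x + 1) y
    · obtain ⟨t, ht, h'⟩ := id hr
      obtain ⟨s, hs, h''⟩ := hP.exchange_up h h' (by omega)
      rw [indicator_of_true hr, indicator_of_true ⟨s, by omega, h''⟩]
    · rw [indicator_of_false hr, indicator_of_false]
      rintro ⟨t, ht, h'⟩
      obtain ⟨s, hs, h''⟩ := hP.exchange_right h h' (by omega)
      exact hr ⟨s, by omega, h''⟩
  · have h1 : RayUp P x y = RayUp P x (y + 1) := by
      refine propext ⟨?_, fun ⟨t, ht, h'⟩ => ⟨t, by omega, h'⟩⟩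
      rintro ⟨t, ht, h'⟩
      rcases ht.eq_or_lt with rfl | ht
      · exact absurd h' h
      · exact ⟨t, by omega, h'⟩
    have h2 : RayRight P x y = RayRight P (x + 1) y := by
      refine propext ⟨?_, fun ⟨t, ht, h'⟩ => ⟨t, by omega, h'⟩⟩
      rintro ⟨t, ht, h'⟩
      rcases ht.eq_or_lt with rfl | ht
      · exact absurd h' h
      · exact ⟨t, by omega, h'⟩
    rw [h1, h2, add_comm]

theorem potential_step_up (hP : IsSymmetricGoodRel P g₁ g₂) (x y : ℤ) :
    potential P x y - potential P x (y + 1) = indicator (RayRight P x y) := by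
  unfold potential
  rcases lt_or_ge y 0 with hy | hy
  · rw [Int.toNat_of_nonpos hy.le, Int.toNat_of_nonpos (by omega : y + 1 ≤ 0),
      indicator_of_false]
    · ring
    · rintro ⟨t, -, h⟩
      have := hP.nonneg_snd h
      omega
  · lift y to ℕ using hy
    have : ((y : ℤ) + 1).toNat = y + 1 := by omega
    rw [this, Finset.sum_range_succ, Int.toNat_natCast]
    ring

/-- `potential` counts along the first axis and then up a column, so a step right replaces the whole
column; `square` telescopes the difference. -/
theorem potential_step_right (hP : IsSymmetricGoodRel P g₁ g₂) (x y : ℤ) :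
    potential P x y - potential P (x + 1) y = indicator (RayUp P x y) := by
  have base : (∑ a ∈ Finset.range (x + 1).toNat, indicator (RayUp P a 0))
      - ∑ a ∈ Finset.range x.toNat, indicator (RayUp P a 0) = indicator (RayUp P x 0) := by
    rcases lt_or_ge x 0 with hx | hx
    · rw [Int.toNat_of_nonpos hx.le, Int.toNat_of_nonpos (by omega : x + 1 ≤ 0),
        indicator_of_false]
      · ring
      · rintro ⟨t, -, h⟩
        have := hP.nonneg_fst h
        omega
    · lift x to ℕ using hx
      have : ((x : ℤ) + 1).toNat = x + 1 := by omega
      rw [this, Finset.sum_range_succ, Int.toNat_natCast]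
      ring
  have column : ∀ n : ℕ, indicator (RayUp P x 0)
      + ∑ b ∈ Finset.range n, indicator (RayRight P (x + 1) b)
      - ∑ b ∈ Finset.range n, indicator (RayRight P x b) = indicator (RayUp P x n) := by
    intro n
    induction n with
    | zero => simp
    | succ n ih =>
      have := hP.square x n
      rw [Finset.sum_range_succ, Finset.sum_range_succ]
      push_cast
      linarith
  have hy : indicator (RayUp P x y) = indicator (RayUp P x (y.toNat : ℤ)) := by
    congr 1
    refine propext ⟨?_, fun ⟨t, ht, h⟩ => ⟨t, by omega, h⟩⟩
    rintro ⟨t, ht, h⟩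
    have := hP.nonneg_snd h
    exact ⟨t, by omega, h⟩
  have := column y.toNat
  unfold potential
  rw [hy]
  linarith

/-! ### Symmetry as a duality of rays and of lengths. -/

/-- Elements on both rays would add up to an element of Δ(γ), which is empty since 0 ∈ S. If both
rays miss `P`, descending induction (`key`) empties the whole column `g₁ - x`; symmetry at a point
so high that its dual has negative height then forces an element in that column. -/
theorem rayUp_iff_not (hP : IsSymmetricGoodRel P g₁ g₂) (x y : ℤ) :
    RayUp P x y ↔ ¬ RayUp P (g₁ - x) (g₂ + 1 - y) := by
  constructor
  · rintro ⟨t, ht, h⟩ ⟨s, hs, h'⟩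
    refine (hP.symm 0 0).1 hP.zero (Or.inl ⟨t + s, by omega, ?_⟩)
    convert hP.add h h' using 1
    ring
  · intro h
    by_contra hn
    have key : ∀ n : ℕ, ¬ RayUp P (g₁ - x) (g₂ + 1 - y - n) := by
      intro n
      induction n with
      | zero => simpa using h
      | succ n ih =>
        rintro ⟨t, ht, ht'⟩
        push_cast at ht
        have hlt : t < g₂ + 1 - y - n := by
          by_contra hc
          exact ih ⟨t, by omega, ht'⟩
        have hxy : ¬ P x (g₂ - t) := fun hc => hn ⟨_, by omega, hc⟩
        rw [hP.symm, not_not, sub_sub_cancel] at hxy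
        rcases hxy with ⟨s, hs, hs'⟩ | ⟨s, hs, hs'⟩
        · exact ih ⟨s, by omega, hs'⟩
        · obtain ⟨r, hr, hr'⟩ := hP.exchange_up ht' hs' hs
          exact ih ⟨r, by omega, hr'⟩
    obtain ⟨n, hn'⟩ : ∃ n : ℕ, g₂ - y < n := ⟨(g₂ - y + 1).toNat, by omega⟩
    have hxy : ¬ P x (y + n) := fun hc => hn ⟨_, by omega, hc⟩
    rw [hP.symm, not_not] at hxy
    rcases hxy with ⟨s, hs, hs'⟩ | ⟨s, hs, hs'⟩
    · exact key n ⟨s, by omega, hs'⟩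
    · have := hP.nonneg_snd hs'
      omega

theorem rayRight_iff_not (hP : IsSymmetricGoodRel P g₁ g₂) (x y : ℤ) :
    RayRight P x y ↔ ¬ RayRight P (g₁ + 1 - x) (g₂ - y) :=
  hP.swap.rayUp_iff_not y x

/-- By ray duality, a unit step and its dual step together contribute 1, which the term `x + y`
absorbs. The constant is never computed: it cancels in `relLength_add_dual`. -/
theorem potential_sub_dual (hP : IsSymmetricGoodRel P g₁ g₂) (x y : ℤ) :
    potential P x y - potential P (g₁ + 1 - x) (g₂ + 1 - y) + x + y =
      potential P 0 0 - potential P (g₁ + 1) (g₂ + 1) := by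
  have right : ∀ x y : ℤ, potential P (x + 1) y
      - potential P (g₁ + 1 - (x + 1)) (g₂ + 1 - y) + (x + 1) + y =
      potential P x y - potential P (g₁ + 1 - x) (g₂ + 1 - y) + x + y := by
    intro x y
    have h1 := hP.potential_step_right x y
    have h2 := hP.potential_step_right (g₁ - x) (g₂ + 1 - y)
    rw [indicator_not (hP.rayUp_iff_not x y)] at h1
    rw [show g₁ - x + 1 = g₁ + 1 - x by ring] at h2
    rw [show g₁ + 1 - (x + 1) = g₁ - x by ring]
    linarith
  have up : ∀ x y : ℤ, potential P x (y + 1)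
      - potential P (g₁ + 1 - x) (g₂ + 1 - (y + 1)) + x + (y + 1) =
      potential P x y - potential P (g₁ + 1 - x) (g₂ + 1 - y) + x + y := by
    intro x y
    have h1 := hP.potential_step_up x y
    have h2 := hP.potential_step_up (g₁ + 1 - x) (g₂ - y)
    rw [indicator_not (hP.rayRight_iff_not x y)] at h1
    rw [show g₂ - y + 1 = g₂ + 1 - y by ring] at h2
    rw [show g₂ + 1 - (y + 1) = g₂ - y by ring]
    linarith
  have row : ∀ x : ℤ, potential P x 0 - potential P (g₁ + 1 - x) (g₂ + 1) + x =
      potential P 0 0 - potential P (g₁ + 1) (g₂ + 1) := by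
    intro x
    induction x using Int.induction_on with
    | zero => simp
    | succ n ih => have := right n 0; simp only [sub_zero, add_zero] at this; linarith
    | pred n ih =>
      have := right (-n - 1) 0
      simp only [sub_zero, add_zero, sub_add_cancel] at this
      linarith
  induction y using Int.induction_on with
  | zero => simpa using row x
  | succ n ih => rw [← ih, up]
  | pred n ih =>
    have := up x (-n - 1)
    rw [sub_add_cancel] at this
    rw [← ih, this]

theorem potential_of_nonpos {x y : ℤ} (hx : x ≤ 0) (hy : y ≤ 0) : potential P x y = 0 := by
  simp [potential, Int.toNat_of_nonpos hx, Int.toNat_of_nonpos hy]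

theorem relLength_add_dual (hP : IsSymmetricGoodRel P g₁ g₂) (e₁ e₂ x y : ℤ) :
    relLength P e₁ e₂ x y + relLength P e₁ e₂ (g₁ + e₁ + 1 - x) (g₂ + e₂ + 1 - y) = e₁ + e₂ := by
  have h1 := hP.potential_sub_dual x y
  have h2 := hP.potential_sub_dual (x - e₁) (y - e₂)
  unfold relLength
  rw [show g₁ + e₁ + 1 - x - e₁ = g₁ + 1 - x by ring,
    show g₂ + e₂ + 1 - y - e₂ = g₂ + 1 - y by ring,
    show g₁ + e₁ + 1 - x = g₁ + 1 - (x - e₁) by ring,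
    show g₂ + e₂ + 1 - y = g₂ + 1 - (y - e₂) by ring]
  linarith

theorem relLength_of_nonpos {e₁ e₂ x y : ℤ} (he₁ : 0 ≤ e₁) (he₂ : 0 ≤ e₂) (hx : x ≤ 0)
    (hy : y ≤ 0) : relLength P e₁ e₂ x y = e₁ + e₂ := by
  rw [relLength, potential_of_nonpos hx hy, potential_of_nonpos (by omega) (by omega)]
  ring

theorem relLength_of_far (hP : IsSymmetricGoodRel P g₁ g₂) {e₁ e₂ x y : ℤ} (he₁ : 0 ≤ e₁)
    (he₂ : 0 ≤ e₂) (hx : g₁ + e₁ + 1 ≤ x) (hy : g₂ + e₂ + 1 ≤ y) :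
    relLength P e₁ e₂ x y = 0 := by
  have := hP.relLength_add_dual e₁ e₂ x y
  rw [relLength_of_nonpos (x := g₁ + e₁ + 1 - x) he₁ he₂ (by omega) (by omega)] at this
  linarith

theorem relLength_step_right (hP : IsSymmetricGoodRel P g₁ g₂) (e₁ e₂ x y : ℤ) :
    relLength P e₁ e₂ x y - relLength P e₁ e₂ (x + 1) y =
      indicator (RayUp P x y) - indicator (RayUp P (x - e₁) (y - e₂)) := by
  rw [← hP.potential_step_right, ← hP.potential_step_right, relLength, relLength,
    show x + 1 - e₁ = x - e₁ + 1 by ring]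
  ring

theorem relLength_step_up (hP : IsSymmetricGoodRel P g₁ g₂) (e₁ e₂ x y : ℤ) :
    relLength P e₁ e₂ x y - relLength P e₁ e₂ x (y + 1) =
      indicator (RayRight P x y) - indicator (RayRight P (x - e₁) (y - e₂)) := by
  rw [← hP.potential_step_up, ← hP.potential_step_up, relLength, relLength,
    show y + 1 - e₂ = y - e₂ + 1 by ring]
  ring

/-! ### Relative length and the Apéry points that detect it. -/

section Translate

variable {e₁ e₂ : ℤ}

theorem rayUp_of_translate (hP : IsSymmetricGoodRel P g₁ g₂) (he : P e₁ e₂) {x y : ℤ}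
    (h : RayUp P (x - e₁) (y - e₂)) : RayUp P x y := by
  obtain ⟨t, ht, h⟩ := h
  refine ⟨t + e₂, by omega, ?_⟩
  convert hP.add h he using 1
  ring

theorem rayRight_of_translate (hP : IsSymmetricGoodRel P g₁ g₂) (he : P e₁ e₂) {x y : ℤ}
    (h : RayRight P (x - e₁) (y - e₂)) : RayRight P x y :=
  hP.swap.rayUp_of_translate he h

theorem relLength_anti (hP : IsSymmetricGoodRel P g₁ g₂) (he : P e₁ e₂) {x y x' y' : ℤ}
    (hx : x ≤ x') (hy : y ≤ y') : relLength P e₁ e₂ x' y' ≤ relLength P e₁ e₂ x y := by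
  have h1 : relLength P e₁ e₂ x' y ≤ relLength P e₁ e₂ x y := by
    induction x', hx using Int.leInduction with
    | base => exact le_rfl
    | succ n _ ih =>
      have := hP.relLength_step_right e₁ e₂ n y
      have := indicator_mono (hP.rayUp_of_translate he (x := n) (y := y))
      linarith
  refine le_trans ?_ h1
  induction y', hy using Int.leInduction with
  | base => exact le_rfl
  | succ n _ ih =>
    have := hP.relLength_step_up e₁ e₂ x' n
    have := indicator_mono (hP.rayRight_of_translate he (x := x') (y := n))
    linarith

theorem relLength_le_right (hP : IsSymmetricGoodRel P g₁ g₂) (x y : ℤ) :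
    relLength P e₁ e₂ x y ≤ relLength P e₁ e₂ (x + 1) y + 1 := by
  have := hP.relLength_step_right e₁ e₂ x y
  have := indicator_le_one (RayUp P x y)
  have := indicator_nonneg (RayUp P (x - e₁) (y - e₂))
  linarith

theorem relLength_le_up (hP : IsSymmetricGoodRel P g₁ g₂) (x y : ℤ) :
    relLength P e₁ e₂ x y ≤ relLength P e₁ e₂ x (y + 1) + 1 := by
  have := hP.relLength_step_up e₁ e₂ x y
  have := indicator_le_one (RayRight P x y)
  have := indicator_nonneg (RayRight P (x - e₁) (y - e₂))
  linarith

/-- If both rays of the translate were met, the infimum would put the point itself in the translate.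
-/
theorem relLength_eq_or (hP : IsSymmetricGoodRel P g₁ g₂) {x y : ℤ} (h : P x y)
    (h' : ¬ P (x - e₁) (y - e₂)) :
    relLength P e₁ e₂ x y = relLength P e₁ e₂ (x + 1) y + 1 ∨
      relLength P e₁ e₂ x y = relLength P e₁ e₂ x (y + 1) + 1 := by
  by_cases hu : RayUp P (x - e₁) (y - e₂)
  · right
    have := hP.relLength_step_up e₁ e₂ x y
    rw [indicator_of_true ⟨x, le_rfl, h⟩,
      indicator_of_false fun hr => h' (hP.mem_of_rays hu hr)] at this
    linarith
  · left
    have := hP.relLength_step_right e₁ e₂ x y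
    rw [indicator_of_true ⟨y, le_rfl, h⟩, indicator_of_false hu] at this
    linarith

/-- Walk right or up, inside the box bounded by γ + **e** + (1,1), as long as the length does not
change. Where the walk stops, both rays meet `P`, and a ray whose step was still available misses
the translate, so the point is an Apéry point. -/
theorem exists_relLength_ge (hP : IsSymmetricGoodRel P g₁ g₂) (he : P e₁ e₂) {x y : ℤ}
    (h : 0 < relLength P e₁ e₂ x y) :
    ∃ x' y', x ≤ x' ∧ y ≤ y' ∧ P x' y' ∧ ¬ P (x' - e₁) (y' - e₂) ∧
      relLength P e₁ e₂ x y ≤ relLength P e₁ e₂ x' y' := by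
  have he₁ := hP.nonneg_fst he
  have he₂ := hP.nonneg_snd he
  obtain ⟨n, hn⟩ : ∃ n, n = (g₁ + e₁ + 1 - x).toNat + (g₂ + e₂ + 1 - y).toNat := ⟨_, rfl⟩
  induction n using Nat.strong_induction_on generalizing x y with
  | _ n ih =>
    by_cases hr : x < g₁ + e₁ + 1 ∧ relLength P e₁ e₂ x y = relLength P e₁ e₂ (x + 1) y
    · obtain ⟨x', y', h1, h2, h3, h4, h5⟩ :=
        ih _ (by omega) (x := x + 1) (y := y) (hr.2 ▸ h) rfl
      exact ⟨x', y', by omega, h2, h3, h4, hr.2 ▸ h5⟩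
    by_cases hu : y < g₂ + e₂ + 1 ∧ relLength P e₁ e₂ x y = relLength P e₁ e₂ x (y + 1)
    · obtain ⟨x', y', h1, h2, h3, h4, h5⟩ :=
        ih _ (by omega) (x := x) (y := y + 1) (hu.2 ▸ h) rfl
      exact ⟨x', y', h1, by omega, h3, h4, hu.2 ▸ h5⟩
    have stepR := hP.relLength_step_right e₁ e₂ x y
    have stepU := hP.relLength_step_up e₁ e₂ x y
    have counted : ∀ p q : Prop, (q → p) → indicator p - indicator q ≠ 0 → p ∧ ¬ q := by
      intro p q hqp hne
      by_cases hq : q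
      · rw [indicator_of_true hq, indicator_of_true (hqp hq)] at hne
        exact absurd rfl hne
      · refine ⟨?_, hq⟩
        by_contra hp
        rw [indicator_of_false hq, indicator_of_false hp] at hne
        exact hne rfl
    have hright : x < g₁ + e₁ + 1 → RayUp P x y ∧ ¬ RayUp P (x - e₁) (y - e₂) := fun hx =>
      counted _ _ (hP.rayUp_of_translate he) fun h0 => hr ⟨hx, by linarith⟩
    have hup : y < g₂ + e₂ + 1 → RayRight P x y ∧ ¬ RayRight P (x - e₁) (y - e₂) := fun hy =>
      counted _ _ (hP.rayRight_of_translate he) fun h0 => hu ⟨hy, by linarith⟩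
    have hU : RayUp P x y := by
      rcases lt_or_ge x (g₁ + e₁ + 1) with hx | hx
      · exact (hright hx).1
      · exact ⟨max y (g₂ + 1), le_max_left _ _,
          hP.far (by omega) ((lt_add_one _).trans_le (le_max_right _ _))⟩
    have hR : RayRight P x y := by
      rcases lt_or_ge y (g₂ + e₂ + 1) with hy | hy
      · exact (hup hy).1
      · exact ⟨max x (g₁ + 1), le_max_left _ _,
          hP.far ((lt_add_one _).trans_le (le_max_right _ _)) (by omega)⟩
    refine ⟨x, y, le_rfl, le_rfl, hP.mem_of_rays hU hR, fun hE => ?_, le_rfl⟩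
    rcases lt_or_ge x (g₁ + e₁ + 1) with hx | hx
    · exact (hright hx).2 ⟨_, le_rfl, hE⟩
    · rcases lt_or_ge y (g₂ + e₂ + 1) with hy | hy
      · exact (hup hy).2 ⟨_, le_rfl, hE⟩
      · rw [hP.relLength_of_far he₁ he₂ hx hy] at h
        exact lt_irrefl _ h

/-- An element to the right at a height strictly between `y` and `t` would, by infimum with `(x,
t)`, give a lower element in column `x`. So the length is constant along column `x + 1` there, and
only the step from `(x, t)` to `(x + 1, t)` counts. -/
theorem relLength_lowest_above (hP : IsSymmetricGoodRel P g₁ g₂) (he : P e₁ e₂) {x y t : ℤ}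
    (hyt : y < t) (h : P x t) (hlow : ∀ s, y < s → s < t → ¬ P x s)
    (hE : ¬ RayUp P (x - e₁) (y + 1 - e₂)) :
    relLength P e₁ e₂ x t = relLength P e₁ e₂ (x + 1) (y + 1) + 1 := by
  have column : ∀ s, y + 1 ≤ s → s ≤ t →
      relLength P e₁ e₂ (x + 1) s = relLength P e₁ e₂ (x + 1) (y + 1) := by
    intro s hs
    induction s, hs using Int.leInduction with
    | base => exact fun _ => rfl
    | succ n hn ih =>
      intro hnt
      have hno : ¬ RayRight P (x + 1) n := by
        rintro ⟨r, hr, h'⟩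
        refine hlow n (by omega) (by omega) ?_
        have := hP.inf h h'
        rwa [min_eq_left (by omega), min_eq_right (by omega)] at this
      have step := hP.relLength_step_up e₁ e₂ (x + 1) n
      rw [indicator_of_false hno,
        indicator_of_false fun hr => hno (hP.rayRight_of_translate he hr)] at step
      rw [← ih (by omega)]
      linarith
  have step := hP.relLength_step_right e₁ e₂ x t
  rw [indicator_of_true ⟨t, le_rfl, h⟩, indicator_of_false, column t (by omega) le_rfl] at step
  · linarith
  · rintro ⟨s, hs, h'⟩
    exact hE ⟨s, by omega, h'⟩

theorem relLength_leftmost_right (hP : IsSymmetricGoodRel P g₁ g₂) (he : P e₁ e₂) {x y t : ℤ}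
    (hxt : x < t) (h : P t y) (hlow : ∀ s, x < s → s < t → ¬ P s y)
    (hE : ¬ RayRight P (x + 1 - e₁) (y - e₂)) :
    relLength P e₁ e₂ t y = relLength P e₁ e₂ (x + 1) (y + 1) + 1 := by
  have row : ∀ s, x + 1 ≤ s → s ≤ t →
      relLength P e₁ e₂ s (y + 1) = relLength P e₁ e₂ (x + 1) (y + 1) := by
    intro s hs
    induction s, hs using Int.leInduction with
    | base => exact fun _ => rfl
    | succ n hn ih =>
      intro hnt
      have hno : ¬ RayUp P n (y + 1) := by
        rintro ⟨r, hr, h'⟩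
        refine hlow n (by omega) (by omega) ?_
        have := hP.inf h h'
        rwa [min_eq_right (by omega), min_eq_left (by omega)] at this
      have step := hP.relLength_step_right e₁ e₂ n (y + 1)
      rw [indicator_of_false hno,
        indicator_of_false fun hr => hno (hP.rayUp_of_translate he hr)] at step
      rw [← ih (by omega)]
      linarith
  have step := hP.relLength_step_up e₁ e₂ t y
  rw [indicator_of_true ⟨t, le_rfl, h⟩, indicator_of_false, row t (by omega) le_rfl] at step
  · linarith
  · rintro ⟨s, hs, h'⟩
    exact hE ⟨s, by omega, h'⟩

end Translate

end IsSymmetricGoodRel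

/-! ### From the semigroup to the relation on ℤ². -/

/-- Membership in `S` for points of `ℤ²`. -/
def IntMem (S : AddSubmonoid (ℕ × ℕ)) (x y : ℤ) : Prop :=
  ∃ s ∈ S, (s.1 : ℤ) = x ∧ (s.2 : ℤ) = y

theorem intMem_natCast {S : AddSubmonoid (ℕ × ℕ)} {a : ℕ × ℕ} :
    IntMem S a.1 a.2 ↔ a ∈ S := by
  constructor
  · rintro ⟨s, hs, h1, h2⟩
    have : s = a := Prod.ext (by exact_mod_cast h1) (by exact_mod_cast h2)
    exact this ▸ hs
  · exact fun h => ⟨a, h, rfl, rfl⟩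

theorem mem_of_conductor_le {S : AddSubmonoid (ℕ × ℕ)} (hS : IsGood S) {a : ℕ × ℕ}
    (h : conductor S ≤ a) : a ∈ S := by
  obtain ⟨n, rfl⟩ := exists_add_of_le h
  exact (isLeast_conductor S hS).1 n

theorem intMem_isSymmetricGoodRel {S : AddSubmonoid (ℕ × ℕ)} (hS : IsGood S)
    (hsymm : IsSymmetric S) :
    IsSymmetricGoodRel (IntMem S) (gammaVec S).1 (gammaVec S).2 := by
  have far : ∀ {x y : ℤ}, (gammaVec S).1 < x → (gammaVec S).2 < y → IntMem S x y := by
    intro x y hx hy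
    simp only [gammaVec] at hx hy
    lift x to ℕ using by omega
    lift y to ℕ using by omega
    exact intMem_natCast (a := (x, y)).2 (mem_of_conductor_le hS ⟨by simp; omega, by simp; omega⟩)
  refine
    { nonneg_fst := ?_, nonneg_snd := ?_, zero := ⟨0, S.zero_mem, rfl, rfl⟩, add := ?_, inf := ?_
      exchange_right := ?_, exchange_up := ?_, far := far, symm := ?_ }
  · rintro x y ⟨s, -, rfl, rfl⟩
    positivity
  · rintro x y ⟨s, -, rfl, rfl⟩
    positivity
  · rintro x y x' y' ⟨s, hs, rfl, rfl⟩ ⟨s', hs', rfl, rfl⟩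
    exact ⟨s + s', S.add_mem hs hs', by simp, by simp⟩
  · rintro x y x' y' ⟨s, hs, rfl, rfl⟩ ⟨s', hs', rfl, rfl⟩
    exact ⟨s ⊓ s', hS.inf_mem _ hs _ hs', by simp, by simp⟩
  · rintro x y y' ⟨s, hs, rfl, rfl⟩ ⟨s', hs', h1, rfl⟩ hlt
    obtain ⟨d, hd, hd1, -, hd2⟩ := hS.exchange_fst s hs s' hs' (by exact_mod_cast h1.symm)
    have := hd2 (by omega)
    exact ⟨d.1, by exact_mod_cast hd1, d, hd, rfl, by omega⟩
  · rintro x y x' ⟨s, hs, rfl, rfl⟩ ⟨s', hs', rfl, h2⟩ hlt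
    obtain ⟨d, hd, hd1, -, hd2⟩ := hS.exchange_snd s hs s' hs' (by exact_mod_cast h2.symm)
    have := hd2 (by omega)
    exact ⟨d.2, by exact_mod_cast hd1, d, hd, by omega, rfl⟩
  · intro x y
    rcases lt_or_ge x 0 with hx | hx
    -- Symmetry is only assumed on ℕ². With a negative coordinate, the dual point exceeds γ in that
    -- coordinate, so its ray reaches the conductor cone.
    · refine iff_of_false ?_ (not_not.2 (Or.inl
        ⟨max ((gammaVec S).2 - y + 1) ((gammaVec S).2 + 1), by omega, far (by omega) (by omega)⟩))
      rintro ⟨s, -, h, -⟩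
      omega
    rcases lt_or_ge y 0 with hy | hy
    · refine iff_of_false ?_ (not_not.2 (Or.inr
        ⟨max ((gammaVec S).1 - x + 1) ((gammaVec S).1 + 1), by omega, far (by omega) (by omega)⟩))
      rintro ⟨s, -, -, h⟩
      omega
    lift x to ℕ using hx
    lift y to ℕ using hy
    rw [intMem_natCast (a := (x, y)), hsymm (x, y), Set.eq_empty_iff_forall_notMem, ← not_exists]
    refine not_congr ⟨?_, ?_⟩
    · rintro ⟨b, hb, ⟨h1, h2⟩ | ⟨h1, h2⟩⟩
      · exact Or.inl ⟨b.2, h2, b, hb, h1, rfl⟩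
      · exact Or.inr ⟨b.1, h2, b, hb, rfl, h1⟩
    · rintro (⟨t, ht, b, hb, h1, rfl⟩ | ⟨t, ht, b, hb, rfl, h1⟩)
      · exact ⟨b, hb, Or.inl ⟨h1, ht⟩⟩
      · exact ⟨b, hb, Or.inr ⟨h1, ht⟩⟩

/-- The relative length of `S` modulo `e + S` above an element of `ℕ²`. On the Apéry set, this is
the index of the layer of the element. -/
noncomputable def aperyLength (S : AddSubmonoid (ℕ × ℕ)) (a : ℕ × ℕ) : ℤ :=
  relLength (IntMem S) (minNonzero S).1 (minNonzero S).2 a.1 a.2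

theorem mem_aperySet_iff {S : AddSubmonoid (ℕ × ℕ)} {a : ℕ × ℕ} :
    a ∈ aperySet S ↔ IntMem S a.1 a.2 ∧
      ¬ IntMem S (a.1 - (minNonzero S).1) (a.2 - (minNonzero S).2) := by
  rw [intMem_natCast]
  refine and_congr_right fun _ => not_congr ?_
  constructor
  · rintro ⟨s, hs, rfl⟩
    exact ⟨s, hs, by simp, by simp⟩
  · rintro ⟨s, hs, h1, h2⟩
    exact ⟨s, hs, Prod.ext (by simp; omega) (by simp; omega)⟩

/-! ### Layers of the Apéry set as level sets of the length. -/

section Layers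

variable {S : AddSubmonoid (ℕ × ℕ)}

theorem intMem_minNonzero (hS : IsGood S) (hl : IsLocal S) :
    IntMem S (minNonzero S).1 (minNonzero S).2 :=
  intMem_natCast.2 (isLeast_minNonzero S hS hl).1.1

theorem exists_aperyLength_ge (hS : IsGood S) (hl : IsLocal S) (hsymm : IsSymmetric S) {x y : ℤ}
    (h : 0 < relLength (IntMem S) (minNonzero S).1 (minNonzero S).2 x y) :
    ∃ b ∈ aperySet S, x ≤ b.1 ∧ y ≤ b.2 ∧
      relLength (IntMem S) (minNonzero S).1 (minNonzero S).2 x y ≤ aperyLength S b := by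
  have hP := intMem_isSymmetricGoodRel hS hsymm
  obtain ⟨x', y', hx, hy, hb, hb', hle⟩ := hP.exists_relLength_ge (intMem_minNonzero hS hl) h
  obtain ⟨b, -, rfl, rfl⟩ := id hb
  exact ⟨b, mem_aperySet_iff.2 ⟨hb, hb'⟩, hx, hy, hle⟩

theorem topLayer_aperyLength (hS : IsGood S) (hl : IsLocal S) (hsymm : IsSymmetric S) (k : ℕ) :
    topLayer {a | a ∈ aperySet S ∧ (k : ℤ) < aperyLength S a} =
      {a | a ∈ aperySet S ∧ aperyLength S a = k + 1} := by
  have hP := intMem_isSymmetricGoodRel hS hsymm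
  have he := intMem_minNonzero hS hl
  set X := {a | a ∈ aperySet S ∧ (k : ℤ) < aperyLength S a}
  ext a
  constructor
  · rintro ⟨⟨⟨ha, hka⟩, hmax⟩, hinf⟩
    refine ⟨ha, ?_⟩
    by_contra hne
    have hR := hP.relLength_le_right (e₁ := (minNonzero S).1) (e₂ := (minNonzero S).2) a.1 a.2
    have hU := hP.relLength_le_up (e₁ := (minNonzero S).1) (e₂ := (minNonzero S).2) a.1 a.2
    change aperyLength S a ≤ _ at hR hU
    -- Length at least `k + 2` at `a` leaves more than `k` at both neighbours, hence elements of `X`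
    -- beyond each. As neither dominates `a` strictly, their infimum is `a`; anything strictly above
    -- them is strictly above `a`, so both are maximal.
    obtain ⟨b, hb, hb1, hb2, hbl⟩ := exists_aperyLength_ge hS hl hsymm
      (x := a.1 + 1) (y := a.2) (by omega)
    obtain ⟨b', hb', hb1', hb2', hbl'⟩ := exists_aperyLength_ge hS hl hsymm
      (x := a.1) (y := a.2 + 1) (by omega)
    have hbX : b ∈ X := ⟨hb, by omega⟩
    have hbX' : b' ∈ X := ⟨hb', by omega⟩
    have hn := hmax b hbX
    have hn' := hmax b' hbX'
    simp only [StrictlyDominated] at hn hn'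
    refine hinf ⟨⟨⟨ha, hka⟩, hmax⟩, b, ⟨⟨hbX, fun d hd hbd => hmax d hd ?_⟩, ?_⟩,
      b', ⟨⟨hbX', fun d hd hbd => hmax d hd ?_⟩, ?_⟩, Prod.ext ?_ ?_⟩
    · exact ⟨by have := hbd.1; omega, by have := hbd.2; omega⟩
    · rintro rfl; omega
    · exact ⟨by have := hbd.1; omega, by have := hbd.2; omega⟩
    · rintro rfl; omega
    · simp only [Prod.fst_inf]; omega
    · simp only [Prod.snd_inf]; omega
  · rintro ⟨ha, hka⟩
    have hor := hP.relLength_eq_or (mem_aperySet_iff.1 ha).1 (mem_aperySet_iff.1 ha).2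
    change aperyLength S a = _ ∨ aperyLength S a = _ at hor
    -- One of the two unit steps from `a` already lowers the length to `k`, so no element of `X`
    -- above `a` is strictly larger in that coordinate. This excludes both strict domination and
    -- being an infimum.
    have hnot : ∀ b b', b ∈ X → b' ∈ X → a ≤ b → a ≤ b' → a.1 < b.1 → a.2 < b'.2 → False := by
      intro b b' hb hb' hab hab' h1 h2
      rcases hor with h | h
      · have := hP.relLength_anti he (show (a.1 : ℤ) + 1 ≤ b.1 by omega)
          (show (a.2 : ℤ) ≤ b.2 by exact_mod_cast hab.2)
        change aperyLength S b ≤ _ at this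
        have := hb.2
        omega
      · have := hP.relLength_anti he (show (a.1 : ℤ) ≤ b'.1 by exact_mod_cast hab'.1)
          (show (a.2 : ℤ) + 1 ≤ b'.2 by omega)
        change aperyLength S b' ≤ _ at this
        have := hb'.2
        omega
    refine ⟨⟨⟨ha, by omega⟩, fun b hb hab =>
      hnot b b hb hb ⟨hab.1.le, hab.2.le⟩ ⟨hab.1.le, hab.2.le⟩ hab.1 hab.2⟩, ?_⟩
    rintro ⟨-, b, ⟨⟨hb, -⟩, hne⟩, b', ⟨⟨hb', -⟩, hne'⟩, hinf⟩
    have hab : a ≤ b := hinf ▸ inf_le_left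
    have hab' : a ≤ b' := hinf ▸ inf_le_right
    have h1 : a.1 = min b.1 b'.1 := congrArg Prod.fst hinf
    have h2 : a.2 = min b.2 b'.2 := congrArg Prod.snd hinf
    have hne1 : ¬ (b.1 = a.1 ∧ b.2 = a.2) := fun h => hne (Prod.ext h.1 h.2)
    have hne2 : ¬ (b'.1 = a.1 ∧ b'.2 = a.2) := fun h => hne' (Prod.ext h.1 h.2)
    rcases lt_or_ge a.1 b.1 with h | h
    · by_cases h' : a.2 < b'.2
      · exact hnot b b' hb hb' hab hab' h h'
      · omega
    · exact hnot b' b hb' hb hab' hab (by omega) (by omega)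

theorem aperyLength_pos (hS : IsGood S) (hl : IsLocal S) (hsymm : IsSymmetric S) {a : ℕ × ℕ}
    (ha : a ∈ aperySet S) : 0 < aperyLength S a := by
  have hP := intMem_isSymmetricGoodRel hS hsymm
  have he := intMem_minNonzero hS hl
  have hnonneg : ∀ x y : ℤ, 0 ≤ relLength (IntMem S) (minNonzero S).1 (minNonzero S).2 x y := by
    intro x y
    rw [← hP.relLength_of_far (e₁ := (minNonzero S).1) (e₂ := (minNonzero S).2)
      (x := max x ((gammaVec S).1 + (minNonzero S).1 + 1))
      (y := max y ((gammaVec S).2 + (minNonzero S).2 + 1)) (by positivity) (by positivity)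
      (le_max_right _ _) (le_max_right _ _)]
    exact hP.relLength_anti he (le_max_left _ _) (le_max_left _ _)
  have hor := hP.relLength_eq_or (mem_aperySet_iff.1 ha).1 (mem_aperySet_iff.1 ha).2
  change aperyLength S a = _ ∨ aperyLength S a = _ at hor
  have := hnonneg (a.1 + 1) a.2
  have := hnonneg a.1 (a.2 + 1)
  omega

theorem aperyRest_eq_aperyLength (hS : IsGood S) (hl : IsLocal S) (hsymm : IsSymmetric S)
    (k : ℕ) : aperyRest S k = {a | a ∈ aperySet S ∧ (k : ℤ) < aperyLength S a} := by
  induction k with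
  | zero =>
    ext a
    exact ⟨fun ha => ⟨ha, by simpa using aperyLength_pos hS hl hsymm ha⟩, fun ha => ha.1⟩
  | succ k ih =>
    rw [aperyRest, ih, topLayer_aperyLength hS hl hsymm]
    ext a
    simp only [Set.mem_sdiff, Set.mem_ofPred_eq]
    push_cast
    constructor
    · rintro ⟨⟨ha, h⟩, h'⟩
      exact ⟨ha, lt_of_le_of_ne h fun h0 => h' ⟨ha, h0.symm⟩⟩
    · rintro ⟨ha, h⟩
      exact ⟨⟨ha, by omega⟩, fun h' => by omega⟩

theorem mem_layerD_iff (hS : IsGood S) (hl : IsLocal S) (hsymm : IsSymmetric S) {k : ℕ}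
    {a : ℕ × ℕ} : a ∈ layerD S k ↔ a ∈ aperySet S ∧ aperyLength S a = k := by
  cases k with
  | zero =>
    refine iff_of_false (fun h => h) fun h => ?_
    have := aperyLength_pos hS hl hsymm h.1
    have := h.2
    omega
  | succ k =>
    rw [layerD, aperyRest_eq_aperyLength hS hl hsymm, topLayer_aperyLength hS hl hsymm]
    simp

theorem aperyLength_zero : aperyLength S 0 = (minNonzero S).1 + (minNonzero S).2 :=
  IsSymmetricGoodRel.relLength_of_nonpos (by positivity) (by positivity) (by simp) (by simp)

theorem zero_mem_aperySet (hS : IsGood S) (hl : IsLocal S) : 0 ∈ aperySet S := by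
  refine ⟨S.zero_mem, ?_⟩
  rintro ⟨s, -, h⟩
  exact (isLeast_minNonzero S hS hl).1.2 (add_eq_zero.1 h).2

/-- The length is largest at 0, which is itself an Apéry element, so its value there is the number
of layers needed. -/
theorem numLevels_eq (hS : IsGood S) (hl : IsLocal S) (hsymm : IsSymmetric S) :
    numLevels S = (minNonzero S).1 + (minNonzero S).2 := by
  have hP := intMem_isSymmetricGoodRel hS hsymm
  have he := intMem_minNonzero hS hl
  have : {N : ℕ | aperySet S = ⋃ i ∈ Set.Icc 1 N, layerD S i} =
      Set.Ici ((minNonzero S).1 + (minNonzero S).2) := by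
    ext N
    simp only [Set.mem_ofPred_eq, Set.mem_Ici]
    constructor
    · intro h
      have h0 := zero_mem_aperySet hS hl
      rw [h] at h0
      simp only [Set.mem_iUnion, mem_layerD_iff hS hl hsymm, aperyLength_zero] at h0
      obtain ⟨i, hi, -, h⟩ := h0
      have := hi.2
      omega
    · intro h
      ext a
      simp only [Set.mem_iUnion, mem_layerD_iff hS hl hsymm]
      refine ⟨fun ha => ?_, fun ⟨i, _, ha, _⟩ => ha⟩
      have hpos := aperyLength_pos hS hl hsymm ha
      have hle := hP.relLength_anti he (show ((0 : ℕ) : ℤ) ≤ a.1 by positivity)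
        (show ((0 : ℕ) : ℤ) ≤ a.2 by positivity)
      change aperyLength S a ≤ aperyLength S 0 at hle
      rw [aperyLength_zero] at hle
      exact ⟨(aperyLength S a).toNat, ⟨by omega, by omega⟩, ha, by omega⟩
  rw [numLevels, this, csInf_Ici]

theorem mem_aperySet_of_mem_deltaS (hsymm : IsSymmetric S) {a b : ℕ × ℕ} (ha : a ∈ S)
    (hb : b ∈ deltaS S (gammaVec S + toIntVec (minNonzero S) - toIntVec a)) :
    b ∈ aperySet S := by
  refine ⟨hb.1, ?_⟩
  rintro ⟨s, hs, rfl⟩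
  have hmem : s ∈ deltaS S (gammaVec S - toIntVec a) := by
    refine ⟨hs, ?_⟩
    have := hb.2
    simp only [toIntVec, Prod.fst_add, Prod.snd_add, Prod.fst_sub, Prod.snd_sub,
      Nat.cast_add] at this ⊢
    omega
  rw [(hsymm a).1 ha] at hmem
  exact hmem

theorem aperyLength_of_minimal (hS : IsGood S) (hl : IsLocal S) (hsymm : IsSymmetric S)
    {a b : ℕ × ℕ} (ha : a ∈ S)
    (hb : Minimal (fun b => b ∈ deltaS S
      (gammaVec S + toIntVec (minNonzero S) - toIntVec a)) b) :
    aperyLength S b + aperyLength S a = (minNonzero S).1 + (minNonzero S).2 + 1 := by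
  have hP := intMem_isSymmetricGoodRel hS hsymm
  have he := intMem_minNonzero hS hl
  have hnot := (hP.symm a.1 a.2).1 (intMem_natCast.2 ha)
  set c := minNonzero S with hc
  set g := gammaVec S with hg
  obtain ⟨x, hx⟩ : ∃ x : ℤ, x = g.1 + c.1 - a.1 := ⟨_, rfl⟩
  obtain ⟨y, hy⟩ : ∃ y : ℤ, y = g.2 + c.2 - a.2 := ⟨_, rfl⟩
  have hdelta : ∀ b : ℕ × ℕ, b ∈ deltaS S (g + toIntVec c - toIntVec a) ↔
      b ∈ S ∧ (((b.1 : ℤ) = x ∧ y < b.2) ∨ ((b.2 : ℤ) = y ∧ x < b.1)) := by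
    intro b
    rw [hx, hy]
    rfl
  have hdual := hP.relLength_add_dual c.1 c.2 a.1 a.2
  -- The dual of `a` is the point diagonally next to the corner `(x, y)` of Δ.
  rw [show g.1 + c.1 + 1 - (a.1 : ℤ) = x + 1 by omega,
    show g.2 + c.2 + 1 - (a.2 : ℤ) = y + 1 by omega] at hdual
  change aperyLength S a + _ = _ at hdual
  have hkey : aperyLength S b = relLength (IntMem S) c.1 c.2 (x + 1) (y + 1) + 1 := by
    obtain ⟨hbS, ⟨h1, h2⟩ | ⟨h1, h2⟩⟩ := (hdelta b).1 hb.1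
    · rw [← h1]
      refine hP.relLength_lowest_above he h2 (intMem_natCast.2 hbS) ?_ ?_
      · rintro s hys hsb ⟨d, hd, hd1, rfl⟩
        have := (hb.2 ((hdelta d).2 ⟨hd, Or.inl ⟨by omega, hys⟩⟩)
          ⟨by exact_mod_cast hd1.le, by exact_mod_cast hsb.le⟩).2
        omega
      -- An element of the translate on this ray, shifted back by **e**, would lie in Δ(γ - `a`),
      -- which is empty by symmetry.
      · rintro ⟨t, ht, h⟩
        refine hnot (Or.inl ⟨t, by omega, ?_⟩)
        rwa [show g.1 - (a.1 : ℤ) = b.1 - c.1 by omega]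
    · rw [← h1]
      refine hP.relLength_leftmost_right he h2 (intMem_natCast.2 hbS) ?_ ?_
      · rintro s hys hsb ⟨d, hd, rfl, hd1⟩
        have := (hb.2 ((hdelta d).2 ⟨hd, Or.inr ⟨by omega, hys⟩⟩)
          ⟨by exact_mod_cast hsb.le, by exact_mod_cast hd1.le⟩).1
        omega
      · rintro ⟨t, ht, h⟩
        refine hnot (Or.inr ⟨t, by omega, ?_⟩)
        rwa [show g.2 - (a.2 : ℤ) = b.2 - c.2 by omega]
  linarith

end Layers

end GoodSemigroup

theorem corollary5p4 (S : AddSubmonoid (ℕ × ℕ)) (hgood : GoodSemigroup.IsGood S)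
    (hlocal : GoodSemigroup.IsLocal S) (hsymm : GoodSemigroup.IsSymmetric S)
    (e : ℕ) (he : e = (GoodSemigroup.minNonzero S).1 + (GoodSemigroup.minNonzero S).2)
    (i : ℕ) (hi : 1 ≤ i) (hie : i ≤ e)
    (α : ℕ × ℕ) (hα : α ∈ GoodSemigroup.aperyLevel S (e - i + 1))
    (β : ℕ × ℕ)
    (hβ : Minimal (fun b => b ∈ GoodSemigroup.deltaS S
      (GoodSemigroup.gammaVec S + GoodSemigroup.toIntVec (GoodSemigroup.minNonzero S)
        - GoodSemigroup.toIntVec α)) β) :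
    β ∈ GoodSemigroup.aperyLevel S i := by
  -- Levels are numbered from below and lengths from above: level `e - i + 1` has length `i`, and
  -- level `i` has length `e + 1 - i`.
  rw [GoodSemigroup.aperyLevel, GoodSemigroup.numLevels_eq hgood hlocal hsymm,
    GoodSemigroup.mem_layerD_iff hgood hlocal hsymm] at hα ⊢
  have := GoodSemigroup.aperyLength_of_minimal hgood hlocal hsymm hα.1.1 hβ
  exact ⟨GoodSemigroup.mem_aperySet_of_mem_deltaS hsymm hα.1.1 hβ.1, by omega⟩
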